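/- Consider two-party Bell scenarios with finitely many inputs $x$ (Alice) and $y$ (Bob) and with $m$ outputs $a$, $b$ for each party. A \emph{box} is a family of conditional probability distributions $P(a,b|x,y)$. It is \emph{no-signalling} if each party's marginal distribution is independent of the other party's input; \emph{classical} if it is a convex mixture of local deterministic boxes; and \emph{quantum} if $P(a,b|x,y)=\mathrm{tr}\big(\rho\,(M_{x,a}\otimes N_{y,b})\big)$ for a density operator $\rho$ on a tensor product of two finite-dimensional complex Hilbert spaces (of any dimensions) and POVMs $(M_{x,a})_a$, $(N_{y,b})_b$. A \emph{Hardy paradox} consists of a set $S_0$ of events $(a,b,x,y)$ and a distinguished event $(a^*,b^*,x^*,y^*)$ such that every classical box with $P(a,b|x,y)=0$ for all $(a,b,x,y)\in S_0$ has $P(a^*,b^*|x^*,y^*)=0$, while some quantum box satisfies the same zero constraints with $P(a^*,b^*|x^*,y^*)>0$. Let $P_c$, $P_q$, $P_{ns}$ denote the largest value (supremum) of $P(a^*,b^*|x^*,y^*)$ over all classical, quantum, and no-signalling boxes, respectively, that satisfy the zero constraints. Then for every $m\ge 3$ there exists a two-party Hardy paradox with $m$ outputs for each party, whose zero constraints are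 satisfied by at least one classical box (so that $P_c=0$), such that $$0<P_q<1\qquad\text{and}\qquad P_{ns}=1,$$ where the value $P_{ns}=1$ is attained by a no-signalling box. Moreover, for the same paradox the supremum remains strictly between $0$ and $1$ if quantum boxes are allowed in the commuting-operator sense, i.e. $P(a,b|x,y)=\langle\psi|M_{x,a}N_{y,b}|\psi\rangle$ for a unit vector $\psi$ of a complex Hilbert space of arbitrary dimension and POVMs of the two parties on that space that commute with each other. -/

import Mathlib

open scoped InnerProductSpace Kronecker ComplexOrder

/-- An event `(a, b, x, y)` of a two-party Bell scenario: outputs `a`, `b` for the inputs `x`, `y`. -/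
abbrev BellEvent (A B X Y : Type) : Type := A × B × X × Y

/-- A two-party table `P a b x y = P(a, b | x, y)`. -/
abbrev BellTable (A B X Y : Type) : Type := A → B → X → Y → ℝ

section Boxes

variable {A B X Y : Type} [Fintype A] [Fintype B]

/-- `P(·, · | x, y)` is a probability distribution for every pair of inputs. -/
def IsBox (P : BellTable A B X Y) : Prop :=
  (∀ a b x y, 0 ≤ P a b x y) ∧ ∀ x y, ∑ a, ∑ b, P a b x y = 1

/-- A no-signalling box: each party's marginal does not depend on the other party's input. -/
def IsNoSignalling (P : BellTable A B X Y) : Prop :=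
  IsBox P ∧
  (∀ a x y y', ∑ b, P a b x y = ∑ b, P a b x y') ∧
  (∀ b x x' y, ∑ a, P a b x y = ∑ a, P a b x' y)

/-- A classical box: a convex mixture of local deterministic boxes `a = f x`, `b = g y`. -/
def IsClassical [DecidableEq A] [DecidableEq B] (P : BellTable A B X Y) : Prop :=
  ∃ (n : ℕ) (q : Fin n → ℝ) (f : Fin n → X → A) (g : Fin n → Y → B),
    (∀ i, 0 ≤ q i) ∧ ∑ i, q i = 1 ∧
    ∀ a b x y, P a b x y = ∑ i, if f i x = a ∧ g i y = b then q i else 0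

/-- A quantum measurement (POVM) with outcomes in `O` on the Hilbert space `ℂ^d`. -/
def IsPOVM {O : Type} [Fintype O] {d : ℕ} (E : O → Matrix (Fin d) (Fin d) ℂ) : Prop :=
  (∀ o, (E o).PosSemidef) ∧ ∑ o, E o = 1

/-- A quantum box: a density matrix `ρ` on `ℂ^dA ⊗ ℂ^dB`, of any finite dimensions, and local
POVMs `M x`, `N y` with `P(a, b | x, y) = tr (ρ (M x a ⊗ N y b))`. -/
def IsQuantum (P : BellTable A B X Y) : Prop :=
  ∃ (dA dB : ℕ) (ρ : Matrix (Fin dA × Fin dB) (Fin dA × Fin dB) ℂ)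
    (M : X → A → Matrix (Fin dA) (Fin dA) ℂ) (N : Y → B → Matrix (Fin dB) (Fin dB) ℂ),
    ρ.PosSemidef ∧ ρ.trace = 1 ∧ (∀ x, IsPOVM (M x)) ∧ (∀ y, IsPOVM (N y)) ∧
    ∀ a b x y, (P a b x y : ℂ) = (ρ * (M x a ⊗ₖ N y b)).trace

/-- A quantum box in the commuting-operator sense: a unit vector `ψ` of a complex Hilbert space
`H` of any dimension, and POVMs of the two parties on `H` that commute with each other, with
`P(a, b | x, y) = ⟪ψ, M x a N y b ψ⟫`. -/
def IsCommutingQuantum (P : BellTable A B X Y) : Prop :=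
  ∃ (H : Type) (_ : NormedAddCommGroup H) (_ : InnerProductSpace ℂ H) (_ : CompleteSpace H)
    (ψ : H) (M : X → A → H →L[ℂ] H) (N : Y → B → H →L[ℂ] H),
    ‖ψ‖ = 1 ∧
    (∀ x, (∀ a, (M x a).IsPositive) ∧ ∑ a, M x a = 1) ∧
    (∀ y, (∀ b, (N y b).IsPositive) ∧ ∑ b, N y b = 1) ∧
    (∀ a b x y, Commute (M x a) (N y b)) ∧
    ∀ a b x y, (P a b x y : ℂ) = ⟪ψ, M x a (N y b ψ)⟫_ℂ

end Boxes

section Hardy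

variable {A B X Y : Type}

/-- The box satisfies the Hardy zero constraints `S₀`. -/
def SatisfiesZeros (S₀ : Set (BellEvent A B X Y)) (P : BellTable A B X Y) : Prop :=
  ∀ a b x y, (a, b, x, y) ∈ S₀ → P a b x y = 0

/-- The values taken by the Hardy probability `P(a_H, b_H | x_H, y_H)` on the boxes of the class
`C` that satisfy the zero constraints `S₀`, where `s = (a_H, b_H, x_H, y_H)`. -/
def hardyValues (C : BellTable A B X Y → Prop) (S₀ : Set (BellEvent A B X Y))
    (s : BellEvent A B X Y) : Set ℝ :=
  {p | ∃ P, C P ∧ SatisfiesZeros S₀ P ∧ P s.1 s.2.1 s.2.2.1 s.2.2.2 = p}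

/-- A two-party Hardy paradox: for classical boxes the zero constraints `S₀` force the Hardy
probability to vanish, while some quantum state and measurements satisfy the zero constraints
with positive Hardy probability. -/
def IsHardyParadox [Fintype A] [Fintype B] [DecidableEq A] [DecidableEq B]
    (S₀ : Set (BellEvent A B X Y)) (s : BellEvent A B X Y) : Prop :=
  (∀ p ∈ hardyValues IsClassical S₀ s, p = 0) ∧ ∃ p ∈ hardyValues IsQuantum S₀ s, 0 < p

end Hardy

/-!
Both parties have three inputs `0, 1, 2`, and the Hardy event is output `0` on both sides for the
inputs `x = y = 2`. The outputs `0, 1` play the CHSH game on the inputs `0, 1`; every further output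
is an *escape* that no rule of the game restricts. The zero constraints `hardyZeros` forbid losing
the game with outputs `0, 1`, and forbid a party to escape on an input `0` or `1` while the other
party outputs `0` on input `2`.

Conditioned on the Hardy event nobody may escape, so the game has to be won perfectly.

* No local deterministic strategy wins CHSH, so the Hardy probability of a classical box is `0`
  (`IsClassical.eq_zero_of_satisfiesZeros`); the box that always escapes satisfies the constraints.
* The Popescu-Rohrlich box wins CHSH with certainty, so no-signalling boxes reach `1` (`prBox`).
* If a no-signalling box has Hardy probability `p`, each party escapes with probability at most
  `1 - p`, whence its CHSH value is at least `16 * p - 12`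
  (`IsNoSignalling.le_mul_correlator_of_satisfiesZeros`). The CHSH value of a commuting-operator
  box is at most `2√2`, of which only the cruder bound `3` is needed
  (`IsCommutingQuantum.chsh_le`); hence `p ≤ 15 / 16`. Quantum boxes are commuting-operator boxes
  by purification of the state (`IsQuantum.isCommutingQuantum`).
* If both parties use only output `0` and one escape output, and always output `0` on input `0`,
  then the constraints that remain are those of Hardy's original paradox. The state
  `(|00⟩ + |01⟩ + |10⟩) / √3` satisfies them with Hardy probability `1 / 12` (`hardyBox`).
-/

/-! ### Commuting-operator boxes -/

open Matrix in
/-- Purification: the vectorisation of a matrix `Bᴴ` with `ρ = Bᴴ * B` turns the state `ρ` into a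
vector state. -/
lemma trace_mul_eq_inner {n : Type} [Fintype n] [DecidableEq n] {ρ : Matrix n n ℂ}
    (hρ : ρ.PosSemidef) :
    ∃ ψ : EuclideanSpace ℂ (n × n), ∀ T : Matrix n n ℂ,
      ⟪ψ, toEuclideanCLM (𝕜 := ℂ) ((1 : Matrix n n ℂ) ⊗ₖ T) ψ⟫_ℂ = (ρ * T).trace := by
  open scoped MatrixOrder in
  obtain ⟨B, rfl⟩ := CStarAlgebra.nonneg_iff_eq_star_mul_self.mp hρ.nonneg
  refine ⟨WithLp.toLp 2 (vec Bᴴ), fun T => ?_⟩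
  rw [toEuclideanCLM_toLp, EuclideanSpace.inner_eq_star_dotProduct, dotProduct_comm,
    ← vec_mul_eq_mulVec, star_vec_dotProduct_vec, conjTranspose_conjTranspose,
    star_eq_conjTranspose, Matrix.mul_assoc Bᴴ, Matrix.trace_mul_comm Bᴴ, Matrix.mul_assoc]

lemma isPositive_toEuclideanCLM {n : Type} [Fintype n] [DecidableEq n] {A : Matrix n n ℂ}
    (hA : A.PosSemidef) : (Matrix.toEuclideanCLM (𝕜 := ℂ) A).IsPositive := by
  rw [← ContinuousLinearMap.isPositive_toLinearMap_iff, Matrix.coe_toEuclideanCLM_eq_toEuclideanLin,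
    Matrix.isPositive_toEuclideanLin_iff]
  exact hA

section

variable {A B X Y : Type} [Fintype A] [Fintype B] {P : BellTable A B X Y}

open Matrix in
/-- Tensor-product boxes are commuting-operator boxes: after purification, Alice acts by
`1 ⊗ (M x a ⊗ 1)` and Bob by `1 ⊗ (1 ⊗ N y b)`. -/
theorem IsQuantum.isCommutingQuantum (hP : IsQuantum P) : IsCommutingQuantum P := by
  obtain ⟨dA, dB, ρ, M, N, hρ, htr, hM, hN, h⟩ := hP
  obtain ⟨ψ, hψ⟩ := trace_mul_eq_inner hρ
  refine ⟨EuclideanSpace ℂ ((Fin dA × Fin dB) × (Fin dA × Fin dB)), inferInstance, inferInstance,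
    inferInstance, ψ,
    fun x a => toEuclideanCLM (𝕜 := ℂ) (1 ⊗ₖ (M x a ⊗ₖ 1)),
    fun y b => toEuclideanCLM (𝕜 := ℂ) (1 ⊗ₖ (1 ⊗ₖ N y b)), ?_, ?_, ?_, ?_, ?_⟩
  · have h1 := hψ 1
    rw [one_kronecker_one, map_one, mul_one, htr, one_apply_eq_self,
      inner_self_eq_norm_sq_to_K] at h1
    have h2 : ‖ψ‖ ^ 2 = 1 := Complex.ofReal_injective (by simpa using h1)
    exact (pow_eq_one_iff_of_nonneg (norm_nonneg ψ) two_ne_zero).1 h2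
  · refine fun x => ⟨fun a => isPositive_toEuclideanCLM
      (PosSemidef.one.kronecker (((hM x).1 a).kronecker PosSemidef.one)), ?_⟩
    have : ∑ a, (1 : Matrix (Fin dA × Fin dB) (Fin dA × Fin dB) ℂ) ⊗ₖ
        (M x a ⊗ₖ (1 : Matrix (Fin dB) (Fin dB) ℂ)) = 1 := by
      trans 1 ⊗ₖ ((∑ a, M x a) ⊗ₖ 1)
      · ext i j
        simp [Matrix.sum_apply, kroneckerMap_apply, Finset.sum_mul, Finset.mul_sum]
      · rw [(hM x).2, one_kronecker_one, one_kronecker_one]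
    rw [← map_sum, this, map_one]
  · refine fun y => ⟨fun b => isPositive_toEuclideanCLM
      (PosSemidef.one.kronecker (PosSemidef.one.kronecker ((hN y).1 b))), ?_⟩
    have : ∑ b, (1 : Matrix (Fin dA × Fin dB) (Fin dA × Fin dB) ℂ) ⊗ₖ
        ((1 : Matrix (Fin dA) (Fin dA) ℂ) ⊗ₖ N y b) = 1 := by
      trans 1 ⊗ₖ (1 ⊗ₖ (∑ b, N y b))
      · ext i j
        simp [Matrix.sum_apply, kroneckerMap_apply, Finset.mul_sum]
      · rw [(hN y).2, one_kronecker_one, one_kronecker_one]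
    rw [← map_sum, this, map_one]
  · intro a b x y
    rw [Commute, SemiconjBy, ← map_mul, ← map_mul]
    simp only [← mul_kronecker_mul, Matrix.one_mul, Matrix.mul_one]
  · intro a b x y
    rw [h, ← hψ, ← mul_apply_eq_comp, ← map_mul]
    simp only [← mul_kronecker_mul, Matrix.one_mul, Matrix.mul_one]

theorem IsCommutingQuantum.isNoSignalling (hP : IsCommutingQuantum P) : IsNoSignalling P := by
  obtain ⟨H, _, _, _, ψ, M, N, hψ, hM, hN, hc, h⟩ := hP
  have hA (a x y) : ((∑ b, P a b x y : ℝ) : ℂ) = ⟪ψ, M x a ψ⟫_ℂ := by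
    push_cast
    simp only [h]
    rw [← inner_sum, ← map_sum, ← _root_.sum_apply, (hN y).2,
      one_apply_eq_self]
  have hB (b x y) : ((∑ a, P a b x y : ℝ) : ℂ) = ⟪ψ, N y b ψ⟫_ℂ := by
    push_cast
    simp only [h]
    rw [← inner_sum, ← _root_.sum_apply, (hM x).2, one_apply_eq_self]
  refine ⟨⟨fun a b x y => ?_, fun x y => ?_⟩, fun a x y y' => ?_, fun b x x' y => ?_⟩
  · have h0 := Commute.mul_nonneg (((M x a).nonneg_iff_isPositive).2 ((hM x).1 a))
      (((N y b).nonneg_iff_isPositive).2 ((hN y).1 b)) (hc a b x y)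
    have h1 := (((M x a * N y b).nonneg_iff_isPositive).1 h0).inner_nonneg_right ψ
    rw [mul_apply_eq_comp, ← h] at h1
    exact_mod_cast h1
  · have : ((∑ a, ∑ b, P a b x y : ℝ) : ℂ) = 1 := by
      rw [Complex.ofReal_sum]
      simp only [hA]
      rw [← inner_sum, ← _root_.sum_apply, (hM x).2, one_apply_eq_self,
        inner_self_eq_norm_sq_to_K, hψ]
      simp
    exact_mod_cast this
  · have : ((∑ b, P a b x y : ℝ) : ℂ) = (∑ b, P a b x y' : ℝ) := by rw [hA, hA]
    exact_mod_cast this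
  · have : ((∑ a, P a b x y : ℝ) : ℂ) = (∑ a, P a b x' y : ℝ) := by rw [hB, hB]
    exact_mod_cast this

/-- The two-valued observable of a POVM, with value `1` on `o₀` and `-1` on all other outcomes, is a
contraction: it is `T - T'` with `T, T'` positive, commuting and `T + T' = 1`, so that
`‖ψ‖² - ‖(T - T') ψ‖² = 4 * re ⟪ψ, T T' ψ⟫ ≥ 0`. -/
lemma norm_sum_sign_smul_apply_le {H O : Type} [NormedAddCommGroup H] [InnerProductSpace ℂ H]
    [CompleteSpace H] [Fintype O] [DecidableEq O] {E : O → H →L[ℂ] H}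
    (hE : ∀ o, (E o).IsPositive) (hsum : ∑ o, E o = 1) (o₀ : O) (ψ : H) :
    ‖(∑ o, (if o = o₀ then (1 : ℝ) else -1) • E o) ψ‖ ≤ ‖ψ‖ := by
  set T := E o₀ with hT
  set T' := ∑ o ∈ Finset.univ.erase o₀, E o with hT'
  have hadd : T + T' = 1 := by rw [hT, hT', Finset.add_sum_erase _ _ (Finset.mem_univ _), hsum]
  have hA : (∑ o, (if o = o₀ then (1 : ℝ) else -1) • E o) = T - T' := by
    rw [← Finset.add_sum_erase _ _ (Finset.mem_univ o₀), if_pos rfl, one_smul, hT', sub_eq_add_neg,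
      ← Finset.sum_neg_distrib]
    congr 1
    refine Finset.sum_congr rfl fun o ho => ?_
    rw [if_neg (Finset.ne_of_mem_erase ho), neg_one_smul]
  have h0 : 0 ≤ T := T.nonneg_iff_isPositive.2 (hE o₀)
  have h0' : 0 ≤ T' := Finset.sum_nonneg fun o _ => (E o).nonneg_iff_isPositive.2 (hE o)
  have hc : Commute T T' := by
    rw [eq_sub_of_add_eq' hadd]
    exact (Commute.one_right T).sub_right (Commute.refl T)
  have h1 := ((T * T').nonneg_iff_isPositive.1 (Commute.mul_nonneg h0 h0' hc)).re_inner_nonneg_right ψ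
  have hTs : ∀ u v, ⟪T u, v⟫_ℂ = ⟪u, T v⟫_ℂ := fun u v =>
    (T.nonneg_iff_isPositive.1 h0).inner_left_eq_inner_right u v
  rw [hA, _root_.sub_apply]
  have h2 : ψ = T ψ + T' ψ := by rw [← _root_.add_apply, hadd]; rfl
  rw [mul_apply_eq_comp, ← hTs] at h1
  refine le_of_sq_le_sq ?_ (norm_nonneg _)
  nth_rewrite 3 [h2]
  rw [@norm_sub_sq ℂ, @norm_add_sq ℂ]
  linarith

/-- The correlator for the inputs `x`, `y` of the two-valued observables that take the value `1` on
`a₀` (resp. `b₀`) and `-1` on every other output. -/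
def correlator [DecidableEq A] [DecidableEq B] (P : BellTable A B X Y) (a₀ : A) (b₀ : B)
    (x : X) (y : Y) : ℝ :=
  ∑ a, ∑ b, (if a = a₀ then 1 else -1) * (if b = b₀ then 1 else -1) * P a b x y

/-- A bound on the CHSH value of commuting-operator boxes between the no-signalling value `4` and
Tsirelson's `2√2`. -/
theorem IsCommutingQuantum.chsh_le [DecidableEq A] [DecidableEq B] (hP : IsCommutingQuantum P)
    (a₀ : A) (b₀ : B) (x₀ x₁ : X) (y₀ y₁ : Y) :
    correlator P a₀ b₀ x₀ y₀ + correlator P a₀ b₀ x₀ y₁ + correlator P a₀ b₀ x₁ y₀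
      - correlator P a₀ b₀ x₁ y₁ ≤ 3 := by
  obtain ⟨H, _, _, _, ψ, M, N, hψ, hM, hN, -, h⟩ := hP
  set u : X → H := fun x => (∑ a, (if a = a₀ then (1 : ℝ) else -1) • M x a) ψ with hu
  set v : Y → H := fun y => (∑ b, (if b = b₀ then (1 : ℝ) else -1) • N y b) ψ with hv
  have hun (x) : ‖u x‖ ^ 2 ≤ 1 := by
    have := norm_sum_sign_smul_apply_le (hM x).1 (hM x).2 a₀ ψ
    rw [hψ] at this
    exact pow_le_one₀ (norm_nonneg _) this
  have hvn (y) : ‖v y‖ ^ 2 ≤ 1 := by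
    have := norm_sum_sign_smul_apply_le (hN y).1 (hN y).2 b₀ ψ
    rw [hψ] at this
    exact pow_le_one₀ (norm_nonneg _) this
  have hE (x y) : correlator P a₀ b₀ x y = (⟪u x, v y⟫_ℂ).re := by
    have key : ∀ a b, P a b x y = (⟪M x a ψ, N y b ψ⟫_ℂ).re := fun a b => by
      rw [((hM x).1 a).inner_left_eq_inner_right, ← h, Complex.ofReal_re]
    simp only [correlator, hu, hv, _root_.sum_apply, sum_inner, inner_sum,
      Complex.re_sum, _root_.smul_apply]
    rw [Finset.sum_comm]
    refine Finset.sum_congr rfl fun b _ => Finset.sum_congr rfl fun a _ => ?_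
    rw [key]
    split_ifs <;> simp
  rw [hE, hE, hE, hE]
  -- `2 * |⟪w, z⟫| ≤ t * ‖w‖² + ‖z‖² / t`; `t = √2` would give `2√2`, the choice `t = 2` gives `3`.
  have young (w z : H) : 4 * (⟪w, z⟫_ℂ).re ≤ 4 * ‖w‖ ^ 2 + ‖z‖ ^ 2 := by
    have : (⟪w, z⟫_ℂ).re ≤ ‖w‖ * ‖z‖ := re_inner_le_norm (𝕜 := ℂ) w z
    linarith [sq_nonneg (2 * ‖w‖ - ‖z‖)]
  have h0 := young (u x₀) (v y₀ + v y₁)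
  have h1 := young (u x₁) (v y₀ - v y₁)
  rw [inner_add_right, Complex.add_re] at h0
  rw [inner_sub_right, Complex.sub_re] at h1
  have h2 := parallelogram_law_with_norm ℂ (v y₀) (v y₁)
  linarith [hun x₀, hun x₁, hvn y₀, hvn y₁]

/-! ### No-signalling boxes -/

theorem IsNoSignalling.swap (hP : IsNoSignalling P) :
    IsNoSignalling (fun b a y x => P a b x y) :=
  ⟨⟨fun b a y x => hP.1.1 a b x y, fun y x => by rw [Finset.sum_comm]; exact hP.1.2 x y⟩,
    fun b y x x' => hP.2.2 b x x' y, fun a y y' x => hP.2.1 a x y y'⟩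

/-- If `p` on Alice's side excludes the output `b₀` of Bob, then Alice's outputs satisfy `p` with
probability at most `1 - P a₀ b₀ x' y'`, whatever the second input: by no-signalling that input may
be taken to be `y'`, and then the outputs in `p` occur only together with outputs other than `b₀`. -/
lemma IsNoSignalling.sum_ite_le (hP : IsNoSignalling P) {p : A → Prop} [DecidablePred p]
    {a₀ : A} {b₀ : B} {x x' : X} {y y' : Y} (hz : ∀ a, p a → P a b₀ x y' = 0) :
    ∑ a, ∑ b, (if p a then P a b x y else 0) ≤ 1 - P a₀ b₀ x' y' := by
  classical
  have h1 : ∑ a, ∑ b, (if p a then P a b x y else 0) =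
      ∑ a, ∑ b, (if p a then P a b x y' else 0) := by
    refine Finset.sum_congr rfl fun a _ => ?_
    split_ifs
    · exact hP.2.1 a x y y'
    · simp
  have h2 : P a₀ b₀ x' y' ≤ ∑ a, P a b₀ x y' := by
    rw [hP.2.2 b₀ x x' y']
    exact Finset.single_le_sum (f := fun a => P a b₀ x' y') (fun a _ => hP.1.1 a b₀ x' y')
      (Finset.mem_univ a₀)
  have h3 : ∑ a, P a b₀ x y' = ∑ a, ∑ b, if b = b₀ then P a b x y' else 0 := by simp
  have h4 : ∑ a, ∑ b, (if p a then P a b x y' else 0) +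
      ∑ a, ∑ b, (if b = b₀ then P a b x y' else 0) ≤ ∑ a, ∑ b, P a b x y' := by
    simp only [← Finset.sum_add_distrib]
    refine Finset.sum_le_sum fun a _ => Finset.sum_le_sum fun b _ => ?_
    have := hP.1.1 a b x y'
    split_ifs with hp hb
    · rw [hb, hz a hp]; simp
    all_goals linarith
  linarith [hP.1.2 x y']

/-- The mirror image of `IsNoSignalling.sum_ite_le`. -/
lemma IsNoSignalling.sum_ite_le' (hP : IsNoSignalling P) {q : B → Prop} [DecidablePred q]
    {a₀ : A} {b₀ : B} {x x' : X} {y y' : Y} (hz : ∀ b, q b → P a₀ b x' y = 0) :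
    ∑ a, ∑ b, (if q b then P a b x y else 0) ≤ 1 - P a₀ b₀ x' y' := by
  rw [Finset.sum_comm]
  exact hP.swap.sum_ite_le hz

/-- If the product of the two signs is `σ` on every possible pair of outputs outside `p` and `q`, the
correlator differs from `σ` by at most twice the probability of `p` or `q`. -/
lemma IsBox.le_mul_correlator [DecidableEq A] [DecidableEq B] (hP : IsBox P) {p : A → Prop}
    {q : B → Prop} [DecidablePred p] [DecidablePred q] {a₀ : A} {b₀ : B} {x : X} {y : Y} {σ : ℝ}
    (hσ : |σ| ≤ 1)
    (h : ∀ a b, ¬ p a → ¬ q b → P a b x y ≠ 0 →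
      σ * ((if a = a₀ then 1 else -1) * (if b = b₀ then 1 else -1)) = 1) :
    1 - 2 * ∑ a, ∑ b, (if p a then P a b x y else 0)
      - 2 * ∑ a, ∑ b, (if q b then P a b x y else 0) ≤ σ * correlator P a₀ b₀ x y := by
  rw [← hP.2 x y, correlator]
  simp only [Finset.mul_sum, ← Finset.sum_sub_distrib]
  refine Finset.sum_le_sum fun a _ => Finset.sum_le_sum fun b _ => ?_
  have h0 := hP.1 a b x y
  obtain ⟨hσ1, hσ2⟩ := abs_le.1 hσ
  by_cases hpq : ¬ p a ∧ ¬ q b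
  · rw [if_neg hpq.1, if_neg hpq.2, ← mul_assoc]
    rcases eq_or_ne (P a b x y) 0 with h' | h'
    · simp [h']
    · rw [h a b hpq.1 hpq.2 h']; linarith
  · have h1 : 1 * P a b x y ≤ (if p a then P a b x y else 0) + if q b then P a b x y else 0 := by
      split_ifs <;> first | linarith | tauto
    have h2 : -P a b x y ≤
        σ * ((if a = a₀ then 1 else -1) * (if b = b₀ then 1 else -1) * P a b x y) := by
      split_ifs <;> nlinarith
    linarith

end

/-! ### The zero constraints -/

section

variable {n : ℕ}

/-- The zero constraints: no escape (an output other than `0, 1`) on an input `0` or `1` while the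
other party outputs `0` on input `2`, and no pair of outputs in `{0, 1}` that loses the CHSH game,
which asks for different outputs on the inputs `x = y = 1` and for equal outputs otherwise. -/
def hardyZeros (n : ℕ) : Set (BellEvent (Fin (n + 3)) (Fin (n + 3)) (Fin 3) (Fin 3)) :=
  {(a, b, x, y) |
    (x = 2 ∧ y ≠ 2 ∧ a = 0 ∧ (b ≠ 0 ∧ b ≠ 1)) ∨
    (x ≠ 2 ∧ y = 2 ∧ b = 0 ∧ (a ≠ 0 ∧ a ≠ 1)) ∨
    (x ≠ 2 ∧ y ≠ 2 ∧ (a = 0 ∨ a = 1) ∧ (b = 0 ∨ b = 1) ∧ (a = b ↔ x = 1 ∧ y = 1))}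

theorem mem_hardyZeros {a b : Fin (n + 3)} {x y : Fin 3} :
    (a, b, x, y) ∈ hardyZeros n ↔
      (x = 2 ∧ y ≠ 2 ∧ a = 0 ∧ (b ≠ 0 ∧ b ≠ 1)) ∨
      (x ≠ 2 ∧ y = 2 ∧ b = 0 ∧ (a ≠ 0 ∧ a ≠ 1)) ∨
      (x ≠ 2 ∧ y ≠ 2 ∧ (a = 0 ∨ a = 1) ∧ (b = 0 ∨ b = 1) ∧ (a = b ↔ x = 1 ∧ y = 1)) :=
  Iff.rfl

lemma outcome_ne : (0 : Fin (n + 3)) ≠ 1 ∧ (0 : Fin (n + 3)) ≠ 2 ∧ (1 : Fin (n + 3)) ≠ 2 := by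
  refine ⟨?_, ?_, ?_⟩ <;> simp [Fin.ext_iff, Nat.mod_eq_of_lt]

variable {P : BellTable (Fin (n + 3)) (Fin (n + 3)) (Fin 3) (Fin 3)}

/-- With probability at least `1 - 2 * (1 - P 0 0 2 2)` neither party escapes on inputs `x, y ≠ 2`, and
then the CHSH game is won. -/
theorem IsNoSignalling.le_mul_correlator_of_satisfiesZeros (hP : IsNoSignalling P)
    (hz : SatisfiesZeros (hardyZeros n) P) {x y : Fin 3} (hx : x ≠ 2) (hy : y ≠ 2) :
    4 * P 0 0 2 2 - 3 ≤ (if x = 1 ∧ y = 1 then -1 else 1) * correlator P 0 0 x y := by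
  have hA := hP.sum_ite_le (p := fun a => a ≠ 0 ∧ a ≠ 1) (a₀ := 0) (b₀ := 0) (x := x) (x' := 2)
    (y := y) (y' := 2) fun a ha => hz _ _ _ _ (Or.inr (Or.inl ⟨hx, rfl, rfl, ha⟩))
  have hB := hP.sum_ite_le' (q := fun b => b ≠ 0 ∧ b ≠ 1) (a₀ := 0) (b₀ := 0) (x := x) (x' := 2)
    (y := y) (y' := 2) fun b hb => hz _ _ _ _ (Or.inl ⟨rfl, hy, rfl, hb⟩)
  have h := hP.1.le_mul_correlator (p := fun a => a ≠ 0 ∧ a ≠ 1) (q := fun b => b ≠ 0 ∧ b ≠ 1)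
    (a₀ := 0) (b₀ := 0) (x := x) (y := y) (σ := if x = 1 ∧ y = 1 then -1 else 1)
    (by split_ifs <;> simp) fun a b ha hb hab => by
      have h01 := (outcome_ne (n := n)).1
      have hn : ¬ (a = b ↔ x = 1 ∧ y = 1) := fun h =>
        hab (hz a b x y (Or.inr (Or.inr ⟨hx, hy, by tauto, by tauto, h⟩)))
      have ha' : a = 0 ∨ a = 1 := by tauto
      have hb' : b = 0 ∨ b = 1 := by tauto
      rcases ha' with rfl | rfl <;> rcases hb' with rfl | rfl <;> simp_all
  linarith

theorem IsCommutingQuantum.le_of_satisfiesZeros (hP : IsCommutingQuantum P)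
    (hz : SatisfiesZeros (hardyZeros n) P) : P 0 0 2 2 ≤ 15 / 16 := by
  have hns := hP.isNoSignalling
  have h := hP.chsh_le 0 0 0 1 0 1
  have h00 := hns.le_mul_correlator_of_satisfiesZeros hz (x := 0) (y := 0) (by decide) (by decide)
  have h01 := hns.le_mul_correlator_of_satisfiesZeros hz (x := 0) (y := 1) (by decide) (by decide)
  have h10 := hns.le_mul_correlator_of_satisfiesZeros hz (x := 1) (y := 0) (by decide) (by decide)
  have h11 := hns.le_mul_correlator_of_satisfiesZeros hz (x := 1) (y := 1) (by decide) (by decide)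
  simp at h00 h01 h10 h11
  linarith

/-! ### Classical boxes and the no-signalling box of value one -/

theorem IsClassical.eq_zero_of_satisfiesZeros (hP : IsClassical P)
    (hz : SatisfiesZeros (hardyZeros n) P) : P 0 0 2 2 = 0 := by
  obtain ⟨k, q, f, g, hq, -, h⟩ := hP
  rw [h]
  refine Finset.sum_eq_zero fun i _ => ?_
  rw [ite_eq_right_iff]
  rintro ⟨hf, hg⟩
  by_contra hi
  -- A strategy of positive weight produces only events outside the zero set.
  have key (x y : Fin 3) : (f i x, g i y, x, y) ∉ hardyZeros n := by
    intro hmem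
    have h0 := hz _ _ _ _ hmem
    rw [h, Finset.sum_eq_zero_iff_of_nonneg fun j _ => by split_ifs <;> simp [hq]] at h0
    exact hi (by simpa using h0 i (Finset.mem_univ i))
  have hB (y : Fin 3) (hy : y ≠ 2) : g i y = 0 ∨ g i y = 1 := by
    have := key 2 y
    rw [mem_hardyZeros] at this
    tauto
  have hA (x : Fin 3) (hx : x ≠ 2) : f i x = 0 ∨ f i x = 1 := by
    have := key x 2
    rw [mem_hardyZeros] at this
    tauto
  have hwin (x y : Fin 3) (hx : x ≠ 2) (hy : y ≠ 2) : ¬ (f i x = g i y ↔ x = 1 ∧ y = 1) :=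
    fun h' => key x y (Or.inr (Or.inr ⟨hx, hy, hA x hx, hB y hy, h'⟩))
  have h00 := hwin 0 0 (by decide) (by decide)
  have h01 := hwin 0 1 (by decide) (by decide)
  have h10 := hwin 1 0 (by decide) (by decide)
  have h11 := hwin 1 1 (by decide) (by decide)
  simp at h00 h01 h10 h11
  exact h11 (h10.trans (h00.symm.trans h01))

/-- The deterministic box in which both parties always escape, with output `2`. -/
def escapeBox (n : ℕ) : BellTable (Fin (n + 3)) (Fin (n + 3)) (Fin 3) (Fin 3) :=
  fun a b _ _ => if 2 = a ∧ 2 = b then 1 else 0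

theorem isClassical_escapeBox : IsClassical (escapeBox n) :=
  ⟨1, fun _ => 1, fun _ _ => 2, fun _ _ => 2, by simp, by simp, by simp [escapeBox]⟩

theorem satisfiesZeros_escapeBox : SatisfiesZeros (hardyZeros n) (escapeBox n) := by
  intro a b x y h
  obtain ⟨-, h02, h12⟩ := outcome_ne (n := n)
  rw [escapeBox, if_neg]
  rintro ⟨rfl, rfl⟩
  rw [mem_hardyZeros] at h
  tauto

/-- The Popescu-Rohrlich box on the inputs `0, 1`, with output `0` fixed on input `2`: for a uniform
bit `r`, Alice outputs `r`, and Bob outputs the bit with which she wins the CHSH game, each party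
with the exception of input `2`. The rule for Bob uses both inputs, but his marginal does not depend
on `x`. -/
noncomputable def prBox (n : ℕ) : BellTable (Fin (n + 3)) (Fin (n + 3)) (Fin 3) (Fin 3) := fun a b x y =>
  ∑ r : Fin 2, if (a = if x = 2 ∨ r = 0 then 0 else 1) ∧
    (b = if y = 2 ∨ (r = 0 ↔ ¬ (x = 1 ∧ y = 1)) then 0 else 1) then 1 / 2 else 0

theorem isNoSignalling_prBox : IsNoSignalling (prBox n) := by
  refine ⟨⟨fun a b x y => ?_, fun x y => ?_⟩, fun a x y y' => ?_, fun b x x' y => ?_⟩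
  · exact Finset.sum_nonneg fun r _ => by split_ifs <;> norm_num
  · simp only [prBox, Fin.sum_univ_two, ite_and, Finset.sum_add_distrib]
    simp
    norm_num
  · simp [prBox, Fin.sum_univ_two, ite_and, Finset.sum_add_distrib]
  · simp only [prBox, Fin.sum_univ_two, ite_and, Finset.sum_add_distrib]
    simp
    fin_cases x <;> fin_cases x' <;> fin_cases y <;> simp [add_comm]

theorem satisfiesZeros_prBox : SatisfiesZeros (hardyZeros n) (prBox n) := by
  intro a b x y h
  obtain ⟨h01, -⟩ := outcome_ne (n := n)
  rw [mem_hardyZeros] at h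
  refine Finset.sum_eq_zero fun r _ => if_neg ?_
  rintro ⟨ha, hb⟩
  split_ifs at ha hb <;> grind

theorem prBox_apply : prBox n 0 0 2 2 = 1 := by
  simp [prBox]

/-! ### The quantum box -/

open Matrix in
lemma trace_mul_im_eq_zero {ι : Type} [Fintype ι] {S T : Matrix ι ι ℂ} (hS : S.IsHermitian)
    (hT : T.IsHermitian) : (S * T).trace.im = 0 := by
  rw [← Complex.conj_eq_iff_im]
  change star _ = _
  rw [← trace_conjTranspose, conjTranspose_mul, hS.eq, hT.eq, trace_mul_comm]

/-- The unnormalised Hardy vector `|00⟩ + |01⟩ + |10⟩`. -/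
def hardyVector : Fin 2 × Fin 2 → ℂ := fun i => if i = (1, 1) then 0 else 1

/-- The density matrix of the normalised Hardy vector. -/
noncomputable def hardyState : Matrix (Fin 2 × Fin 2) (Fin 2 × Fin 2) ℂ :=
  (1 / 3 : ℂ) • Matrix.vecMulVec hardyVector (star hardyVector)

/-- The projection for output `0` on the inputs `0, 1, 2`: the identity, `|1⟩⟨1|` and `|-⟩⟨-|`. -/
noncomputable def hardyEffect : Fin 3 → Matrix (Fin 2) (Fin 2) ℂ :=
  ![1, !![0, 0; 0, 1], !![1 / 2, -1 / 2; -1 / 2, 1 / 2]]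

/-- The measurement with outputs `0` and `2` whose effect for output `0` is `hardyEffect x`; both
parties use it. -/
noncomputable def hardyPOVM (n : ℕ) (x : Fin 3) (a : Fin (n + 3)) : Matrix (Fin 2) (Fin 2) ℂ :=
  if a = 0 then hardyEffect x else if a = 2 then 1 - hardyEffect x else 0

/-- The box of the Hardy state measured with `hardyPOVM` on both sides. The traces are real, so that
nothing is lost in passing to the real part. -/
noncomputable def hardyBox (n : ℕ) : BellTable (Fin (n + 3)) (Fin (n + 3)) (Fin 3) (Fin 3) :=
  fun a b x y => (hardyState * (hardyPOVM n x a ⊗ₖ hardyPOVM n y b)).trace.re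

lemma posSemidef_hardyState : hardyState.PosSemidef :=
  (Matrix.posSemidef_vecMulVec_self_star _).smul (by rw [Complex.le_def]; norm_num)

lemma trace_hardyState : hardyState.trace = 1 := by
  simp [hardyState, hardyVector, Matrix.trace, Matrix.vecMulVec_apply, Fintype.sum_prod_type]
  norm_num

lemma isStarProjection_hardyEffect (x : Fin 3) : IsStarProjection (hardyEffect x) := by
  constructor
  · fin_cases x
    · exact IsIdempotentElem.one
    all_goals
      ext i j
      fin_cases i <;> fin_cases j <;> simp [hardyEffect, Matrix.mul_apply] <;> norm_num
  · fin_cases x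
    · exact IsSelfAdjoint.one _
    all_goals
      ext i j
      fin_cases i <;> fin_cases j <;> simp [hardyEffect, Matrix.star_apply]

lemma IsStarProjection.posSemidef {ι : Type} [Fintype ι] {E : Matrix ι ι ℂ}
    (hE : IsStarProjection E) : E.PosSemidef := by
  have := Matrix.posSemidef_conjTranspose_mul_self E
  rwa [← Matrix.star_eq_conjTranspose, hE.isSelfAdjoint.star_eq, hE.isIdempotentElem.eq] at this

lemma isPOVM_hardyPOVM (x : Fin 3) : IsPOVM (hardyPOVM n x) := by
  obtain ⟨-, h02, -⟩ := outcome_ne (n := n)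
  have hE := isStarProjection_hardyEffect x
  refine ⟨fun a => ?_, ?_⟩
  · unfold hardyPOVM
    split_ifs
    exacts [hE.posSemidef, hE.one_sub.posSemidef, .zero]
  · have (a : Fin (n + 3)) : hardyPOVM n x a =
        (if a = 0 then hardyEffect x else 0) + if a = 2 then 1 - hardyEffect x else 0 := by
      unfold hardyPOVM
      split_ifs with h0 h2 <;> first | (exact absurd (h0.symm.trans h2) h02) | simp
    simp [this, Finset.sum_add_distrib]

theorem isQuantum_hardyBox : IsQuantum (hardyBox n) := by
  refine ⟨2, 2, hardyState, hardyPOVM n, hardyPOVM n, posSemidef_hardyState, trace_hardyState,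
    isPOVM_hardyPOVM, isPOVM_hardyPOVM, fun a b x y => ?_⟩
  have := trace_mul_im_eq_zero posSemidef_hardyState.isHermitian
    (((isPOVM_hardyPOVM (n := n) x).1 a).kronecker ((isPOVM_hardyPOVM (n := n) y).1 b)).isHermitian
  exact Complex.ext rfl this.symm

/-- On input `2`, output `0` of one party leaves the other in the state `|1⟩`, for which the outputs on
the inputs `0, 1` are `0`; and the Hardy vector has no component along `|11⟩`. -/
theorem satisfiesZeros_hardyBox : SatisfiesZeros (hardyZeros n) (hardyBox n) := by
  obtain ⟨h01, h02, h12⟩ := outcome_ne (n := n)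
  intro a b x y h
  rw [mem_hardyZeros] at h
  rcases h with ⟨rfl, hy, rfl, hb, -⟩ | ⟨hx, rfl, rfl, ha, -⟩ | ⟨hx, hy, ha, hb, hab⟩
  · rcases eq_or_ne b 2 with rfl | hb2
    · have hy01 : y = 0 ∨ y = 1 := by omega
      rcases hy01 with rfl | rfl <;>
        simp [hardyBox, hardyPOVM, hardyState, hardyVector, hardyEffect, Matrix.trace,
          Matrix.mul_apply, Matrix.vecMulVec_apply, Fintype.sum_prod_type,
          Matrix.kroneckerMap_apply, h02.symm]
      norm_num
    · simp [hardyBox, hardyPOVM, hb, hb2]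
  · rcases eq_or_ne a 2 with rfl | ha2
    · have hx01 : x = 0 ∨ x = 1 := by omega
      rcases hx01 with rfl | rfl <;>
        simp [hardyBox, hardyPOVM, hardyState, hardyVector, hardyEffect, Matrix.trace,
          Matrix.mul_apply, Matrix.vecMulVec_apply, Fintype.sum_prod_type,
          Matrix.kroneckerMap_apply, h02.symm]
      norm_num
    · simp [hardyBox, hardyPOVM, ha, ha2]
  · rcases ha with rfl | rfl
    · rcases hb with rfl | rfl
      · obtain ⟨rfl, rfl⟩ := hab.1 rfl
        simp [hardyBox, hardyPOVM, hardyState, hardyVector, hardyEffect, Matrix.trace,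
          Matrix.mul_apply, Matrix.vecMulVec_apply, Fintype.sum_prod_type,
          Matrix.kroneckerMap_apply]
      · simp [hardyBox, hardyPOVM, h01.symm, h12]
    · simp [hardyBox, hardyPOVM, h01.symm, h12]

theorem hardyBox_apply : hardyBox n 0 0 2 2 = 1 / 12 := by
  simp [hardyBox, hardyPOVM, hardyState, hardyVector, hardyEffect, Matrix.trace,
    Matrix.mul_apply, Matrix.vecMulVec_apply, Fintype.sum_prod_type, Matrix.kroneckerMap_apply]
  norm_num

lemma exists_isLUB_between {S : Set ℝ} {a b c : ℝ} (ha : a ∈ S) (hb : ∀ p ∈ S, p ≤ b)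
    (ha0 : 0 < a) (hbc : b < c) : ∃ p, IsLUB S p ∧ 0 < p ∧ p < c := by
  have h := isLUB_csSup ⟨a, ha⟩ ⟨b, hb⟩
  exact ⟨sSup S, h, ha0.trans_le (h.1 ha), (h.2 hb).trans_lt hbc⟩

end

theorem mainTheorem8 (m : ℕ) (hm : 3 ≤ m) :
    ∃ (k l : ℕ) (S₀ : Set (BellEvent (Fin m) (Fin m) (Fin k) (Fin l)))
      (s : BellEvent (Fin m) (Fin m) (Fin k) (Fin l)),
      IsHardyParadox S₀ s ∧
      IsGreatest (hardyValues IsClassical S₀ s) 0 ∧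
      (∃ pq : ℝ, IsLUB (hardyValues IsQuantum S₀ s) pq ∧ 0 < pq ∧ pq < 1) ∧
      (∃ pc : ℝ, IsLUB (hardyValues IsCommutingQuantum S₀ s) pc ∧ 0 < pc ∧ pc < 1) ∧
      IsGreatest (hardyValues IsNoSignalling S₀ s) 1 := by
  obtain ⟨n, rfl⟩ := Nat.exists_eq_add_of_le' hm
  have hc : ∀ p ∈ hardyValues IsClassical (hardyZeros n) (0, 0, 2, 2), p = 0 := by
    rintro _ ⟨P, hP, hz, rfl⟩
    exact hP.eq_zero_of_satisfiesZeros hz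
  have hq : 1 / 12 ∈ hardyValues IsQuantum (hardyZeros n) (0, 0, 2, 2) :=
    ⟨hardyBox n, isQuantum_hardyBox, satisfiesZeros_hardyBox, hardyBox_apply⟩
  have hcq : ∀ p ∈ hardyValues IsCommutingQuantum (hardyZeros n) (0, 0, 2, 2), p ≤ 15 / 16 := by
    rintro _ ⟨P, hP, hz, rfl⟩
    exact hP.le_of_satisfiesZeros hz
  have hsub : hardyValues IsQuantum (hardyZeros n) (0, 0, 2, 2) ⊆
      hardyValues IsCommutingQuantum (hardyZeros n) (0, 0, 2, 2) := by
    rintro _ ⟨P, hP, hz, rfl⟩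
    exact ⟨P, hP.isCommutingQuantum, hz, rfl⟩
  refine ⟨3, 3, hardyZeros n, (0, 0, 2, 2), ⟨hc, 1 / 12, hq, by norm_num⟩,
    ⟨⟨escapeBox n, isClassical_escapeBox, satisfiesZeros_escapeBox, ?_⟩, fun p hp => (hc p hp).le⟩,
    exists_isLUB_between hq (fun p hp => hcq p (hsub hp)) (by norm_num) (by norm_num),
    exists_isLUB_between (hsub hq) hcq (by norm_num) (by norm_num),
    ⟨prBox n, isNoSignalling_prBox, satisfiesZeros_prBox, prBox_apply⟩, ?_⟩
  · exact if_neg fun h => outcome_ne.2.1 h.1.symm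
  · rintro _ ⟨P, hP, -, rfl⟩
    rw [← hP.1.2 2 2]
    exact (Finset.single_le_sum (fun b _ => hP.1.1 0 b 2 2) (Finset.mem_univ 0)).trans
      (Finset.single_le_sum (f := fun a => ∑ b, P a b 2 2)
        (fun a _ => Finset.sum_nonneg fun b _ => hP.1.1 a b 2 2) (Finset.mem_univ 0))
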